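/- Fix a spot price $S>0$ and a strike $K>0$, and let $C(T)$, $0<T<T_0$, be the market price of the European call with strike $K$ and maturity $T$ (zero interest rate), with $(S-K)_+\le C(T)<S$; no model is assumed. Let $n(x)=\frac1{\sqrt{2\pi}}e^{-x^2/2}$, $N(x)=\int_{-\infty}^x n(u)\,du$ and $\mathrm{erf}(x)=\frac{2}{\sqrt\pi}\int_0^x e^{-t^2}\,dt$. The normal implied volatility $\sigma_N=\sigma_N(T)\ge 0$ is the unique number with $$C(T)=(S-K)\,N\!\left(\frac{S-K}{\sigma_N\sqrt T}\right)+\sigma_N\sqrt T\,n\!\left(\frac{S-K}{\sigma_N\sqrt T}\right),$$ and the lognormal implied volatility $\sigma_{LN}=\sigma_{LN}(T)\ge 0$ is the unique number with $$C(T)=S\,N\!\left(\frac{\ln S-\ln K}{\sigma_{LN}\sqrt T}+\frac{\sigma_{LN}\sqrt T}{2}\right)-K\,N\!\left(\frac{\ln S-\ln K}{\sigma_{LN}\sqrt T}-\frac{\sigma_{LN}\sqrt T}{2}\right),$$ where for a volatility equal to $0$ both right-hand sides are read as $(S-K)_+$. (1) Let $K\neq S$. If $\sigma_{LN}(T)$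 remains bounded as $T\to0^+$, then, as $T\to 0^+$, $$\sigma_N=\frac{S-K}{\ln S-\ln K}\,\sigma_{LN}\left[1-\frac{\ln\left(\frac{1}{\sqrt{KS}}\,\frac{S-K}{\ln S-\ln K}\right)}{(\ln S-\ln K)^2}\,\sigma_{LN}^2T\right]+O(T^2\ln T).$$ Moreover $\sigma_N\sim\frac{S-K}{\ln S-\ln K}\,\sigma_{LN}$ as $T\to 0^+$ whenever $C(T)\to(S-K)_+$ as $T\to0^+$ (in particular whenever $\sigma_{LN}$ remains bounded). (2) Let $K=S$. Then for every $T\in(0,T_0)$ $$\sigma_N=\sqrt{\frac{2\pi}{T}}\;S\;\mathrm{erf}\!\left(\frac{\sigma_{LN}\sqrt T}{2\sqrt2}\right).$$ If $\sigma_{LN}(T)$ remains bounded as $T\to0^+$, then $\sigma_N=S\,\sigma_{LN}\left(1-\frac{\sigma_{LN}^2T}{24}\right)+o(T)$ as $T\to 0^+$. Moreover $\sigma_N\sim S\,\sigma_{LN}$ as $T\to0^+$ whenever $C(T)\to(S-K)_+=0$ as $T\to0^+$ (in particular whenever $\sigma_{LN}$ remains bounded). -/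

import Mathlib

open Set Filter Topology Asymptotics MeasureTheory

noncomputable section

/-- The standard normal density `n`. -/
def normalDensity (x : ℝ) : ℝ := 1 / Real.sqrt (2 * Real.pi) * Real.exp (-(x ^ 2 / 2))

/-- The standard normal distribution function `N`. -/
def normalCDF (x : ℝ) : ℝ := ∫ u in Iic x, normalDensity u

/-- The error function. -/
def errorFunction (x : ℝ) : ℝ := 2 / Real.sqrt Real.pi * ∫ t in (0 : ℝ)..x, Real.exp (-(t ^ 2))

/-- The price of a call with spot `S`, strike `K` and maturity `T` in the Bachelier model with
normal volatility `σ` (and zero interest rate). When `σ √T = 0` the closed formula is to be read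
as its limit, the intrinsic value `(S - K)₊`. -/
def bachelierCall (S K T σ : ℝ) : ℝ :=
  if σ * Real.sqrt T = 0 then max (S - K) 0
  else
    (S - K) * normalCDF ((S - K) / (σ * Real.sqrt T))
      + σ * Real.sqrt T * normalDensity ((S - K) / (σ * Real.sqrt T))

/-- The price of a call with spot `S`, strike `K` and maturity `T` in the Black-Scholes model with
lognormal volatility `σ` (and zero interest rate). When `σ √T = 0` the closed formula is to be read
as its limit, the intrinsic value `(S - K)₊`. -/
def blackScholesCall (S K T σ : ℝ) : ℝ :=
  if σ * Real.sqrt T = 0 then max (S - K) 0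
  else
    S * normalCDF ((Real.log S - Real.log K) / (σ * Real.sqrt T) + σ * Real.sqrt T / 2)
      - K * normalCDF ((Real.log S - Real.log K) / (σ * Real.sqrt T) - σ * Real.sqrt T / 2)

/-- The normal implied volatility of the call price `c`: the volatility `σ ≥ 0` for which the
Bachelier price is `c`. For `T > 0` there is exactly one such `σ` when `(S - K)₊ ≤ c`, and the
infimum below is over that single value. -/
def normalImpliedVol (S K T c : ℝ) : ℝ := sInf {σ : ℝ | 0 ≤ σ ∧ bachelierCall S K T σ = c}

/-- The lognormal implied volatility of the call price `c`: the volatility `σ ≥ 0` for which the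
Black-Scholes price is `c`. For `S, K, T > 0` there is exactly one such `σ` when
`(S - K)₊ ≤ c < S`, and the infimum below is over that single value. -/
def lognormalImpliedVol (S K T c : ℝ) : ℝ := sInf {σ : ℝ | 0 ≤ σ ∧ blackScholesCall S K T σ = c}

end

/-! ### The normal distribution -/

/-! Both prices depend on maturity only through the total volatilities `w = σN √T` and `v = σLN √T`,
so everything reduces to the relation `bachelierCall S K 1 w = blackScholesCall S K 1 v` for small
`v`. Both sides increase strictly from `(S - K)₊`, and their derivatives are explicit Gaussians, so
the relation is studied by comparing vegas; no asymptotics of the prices are needed.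

Let `x = log S - log K ≠ 0` and insert `w = A v (1 - B v² + M v⁴)` into the Bachelier price. Its
derivative in `v` is the Black-Scholes vega times `exp (L (v²))`. The choice `A = (S - K) / x`
matches the singular exponents `-x² / (2 v²)`, and the choice of `B` gives `L 0 = 0`. The slope of
`L` at `0` is affine in `M` with coefficient `x²`, so suitable `M` make it `1` and `-1`. The two
quintics then give prices above and below the Black-Scholes price, and monotonicity traps the true
`w` between them, within `O(v⁵)` of `A v (1 - B v²)` (`exists_abs_bachelier_totalVol_sub_le`).

At the money `x = 0` and `M` loses its influence on the slope, but there the relation is explicit: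
`w = S ∫₀ᵛ exp (-u² / 8) du`, an error function, whose Taylor expansion is the same kind of bound
with `B = 1 / 24`.

Dividing by `√T` gives an error `O(T²)` when `σLN` is bounded. The equivalences need only `v → 0`,
which follows from `C T → (S - K)₊` by strict monotonicity. -/

theorem normalDensity_pos (x : ℝ) : 0 < normalDensity x := by
  unfold normalDensity; positivity

theorem continuous_normalDensity : Continuous normalDensity := by
  unfold normalDensity; fun_prop

theorem normalDensity_le_one (x : ℝ) : normalDensity x ≤ 1 := by
  unfold normalDensity
  have h1 : 1 / Real.sqrt (2 * Real.pi) ≤ 1 := by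
    rw [div_le_one (by positivity)]
    exact Real.one_le_sqrt.2 (by linarith [Real.pi_gt_three])
  have h2 : Real.exp (-(x ^ 2 / 2)) ≤ 1 := Real.exp_le_one_iff.2 (by nlinarith [sq_nonneg x])
  exact mul_le_one₀ h1 (Real.exp_nonneg _) h2

theorem normalDensity_eq_gaussianPDFReal :
    normalDensity = ProbabilityTheory.gaussianPDFReal 0 1 := by
  ext x
  simp [normalDensity, ProbabilityTheory.gaussianPDFReal, neg_div]

theorem integrable_normalDensity : Integrable normalDensity := by
  rw [normalDensity_eq_gaussianPDFReal]
  exact ProbabilityTheory.integrable_gaussianPDFReal 0 1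

theorem integral_normalDensity : ∫ x, normalDensity x = 1 := by
  rw [normalDensity_eq_gaussianPDFReal]
  exact ProbabilityTheory.integral_gaussianPDFReal_eq_one 0 one_ne_zero

theorem hasDerivAt_normalDensity (x : ℝ) :
    HasDerivAt normalDensity (-x * normalDensity x) x := by
  unfold normalDensity
  have h := ((((hasDerivAt_id x).pow 2).div_const 2).neg.exp).const_mul
    (1 / Real.sqrt (2 * Real.pi))
  refine h.congr_deriv ?_
  simp only [id, Pi.pow_apply, Pi.neg_apply, Nat.cast_ofNat]
  ring

theorem normalCDF_sub_normalCDF (a b : ℝ) :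
    normalCDF b - normalCDF a = ∫ u in a..b, normalDensity u :=
  intervalIntegral.integral_Iic_sub_Iic integrable_normalDensity.integrableOn
    integrable_normalDensity.integrableOn

theorem hasDerivAt_normalCDF (x : ℝ) : HasDerivAt normalCDF (normalDensity x) x := by
  have h : normalCDF = fun y => normalCDF 0 + ∫ u in (0 : ℝ)..y, normalDensity u := by
    ext y
    linarith [normalCDF_sub_normalCDF 0 y]
  rw [h]
  exact (continuous_normalDensity.integral_hasStrictDerivAt 0 x).hasDerivAt.const_add _

theorem continuous_normalCDF : Continuous normalCDF :=
  continuous_iff_continuousAt.2 fun x => (hasDerivAt_normalCDF x).continuousAt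

theorem tendsto_normalCDF_atBot : Tendsto normalCDF atBot (𝓝 0) := by
  have h := intervalIntegral_tendsto_integral_Iic (f := normalDensity) 0
    integrable_normalDensity.integrableOn tendsto_id
  have h2 : normalCDF = fun y => normalCDF 0 - ∫ u in y..(0 : ℝ), normalDensity u := by
    ext y
    linarith [normalCDF_sub_normalCDF y 0]
  rw [h2]
  simpa [normalCDF] using h.const_sub (normalCDF 0)

theorem tendsto_normalCDF_atTop : Tendsto normalCDF atTop (𝓝 1) := by
  have h := intervalIntegral_tendsto_integral_Ioi (f := normalDensity) 0
    integrable_normalDensity.integrableOn tendsto_id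
  have h2 : normalCDF = fun y => normalCDF 0 + ∫ u in (0 : ℝ)..y, normalDensity u := by
    ext y
    linarith [normalCDF_sub_normalCDF 0 y]
  have h3 : normalCDF 0 + ∫ u in Ioi (0 : ℝ), normalDensity u = 1 := by
    rw [← integral_normalDensity]
    exact intervalIntegral.integral_Iic_add_Ioi integrable_normalDensity.integrableOn
      integrable_normalDensity.integrableOn
  rw [h2, ← h3]
  exact h.const_add _

/-! ### Call prices as functions of the total volatility `σ √T` -/

theorem bachelierCall_eq_one (S K T σ : ℝ) :
    bachelierCall S K T σ = bachelierCall S K 1 (σ * Real.sqrt T) := by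
  simp [bachelierCall]

theorem blackScholesCall_eq_one (S K T σ : ℝ) :
    blackScholesCall S K T σ = blackScholesCall S K 1 (σ * Real.sqrt T) := by
  simp [blackScholesCall]

theorem bachelierCall_zero (S K T : ℝ) : bachelierCall S K T 0 = max (S - K) 0 := by
  simp [bachelierCall]

theorem blackScholesCall_zero (S K T : ℝ) : blackScholesCall S K T 0 = max (S - K) 0 := by
  simp [blackScholesCall]

theorem bachelierCall_one_of_pos (S K : ℝ) {w : ℝ} (hw : 0 < w) :
    bachelierCall S K 1 w =
      (S - K) * normalCDF ((S - K) / w) + w * normalDensity ((S - K) / w) := by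
  simp [bachelierCall, hw.ne']

theorem blackScholesCall_one_of_pos (S K : ℝ) {v : ℝ} (hv : 0 < v) :
    blackScholesCall S K 1 v =
      S * normalCDF ((Real.log S - Real.log K) / v + v / 2)
        - K * normalCDF ((Real.log S - Real.log K) / v - v / 2) := by
  simp [blackScholesCall, hv.ne']

/-- Since `n' y = -y n y` and `w y = S - K` at `y = (S - K) / w`, the two terms containing the
derivative of `y` cancel. -/
theorem hasDerivAt_bachelierCall (S K : ℝ) {w : ℝ} (hw : 0 < w) :
    HasDerivAt (bachelierCall S K 1) (normalDensity ((S - K) / w)) w := by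
  have hd : HasDerivAt (fun u : ℝ => (S - K) / u) (-(S - K) / w ^ 2) w := by
    simpa [div_eq_mul_inv, -neg_sub] using (hasDerivAt_inv hw.ne').const_mul (S - K)
  have h := (((hasDerivAt_normalCDF ((S - K) / w)).comp w hd).const_mul (S - K)).add
    ((hasDerivAt_id w).mul ((hasDerivAt_normalDensity ((S - K) / w)).comp w hd))
  have h' : HasDerivAt (fun u => (S - K) * normalCDF ((S - K) / u)
      + u * normalDensity ((S - K) / u)) (normalDensity ((S - K) / w)) w := by
    refine h.congr_deriv ?_
    simp only [Function.comp, id]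
    field_simp
    ring
  refine h'.congr_of_eventuallyEq ?_
  filter_upwards [lt_mem_nhds hw] with u hu using bachelierCall_one_of_pos S K hu

theorem normalDensity_add_half {x v : ℝ} (hv : v ≠ 0) :
    normalDensity (x / v + v / 2)
      = Real.exp (-(x / 2)) * (normalDensity (x / v) * Real.exp (-(v ^ 2 / 8))) := by
  unfold normalDensity
  have : -((x / v + v / 2) ^ 2 / 2) = -(x / 2) + (-((x / v) ^ 2 / 2) + -(v ^ 2 / 8)) := by
    field_simp; ring
  rw [this, Real.exp_add, Real.exp_add]; ring

theorem normalDensity_sub_half {x v : ℝ} (hv : v ≠ 0) :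
    normalDensity (x / v - v / 2)
      = Real.exp (x / 2) * (normalDensity (x / v) * Real.exp (-(v ^ 2 / 8))) := by
  unfold normalDensity
  have : -((x / v - v / 2) ^ 2 / 2) = x / 2 + (-((x / v) ^ 2 / 2) + -(v ^ 2 / 8)) := by
    field_simp; ring
  rw [this, Real.exp_add, Real.exp_add]; ring

theorem mul_exp_half_log {S K : ℝ} (hS : 0 < S) (hK : 0 < K) :
    S * Real.exp (-((Real.log S - Real.log K) / 2)) = Real.sqrt (K * S) := by
  symm
  rw [Real.sqrt_eq_iff_mul_self_eq (by positivity) (by positivity)]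
  have : S * Real.exp (-((Real.log S - Real.log K) / 2)) *
      (S * Real.exp (-((Real.log S - Real.log K) / 2)))
      = S * S * Real.exp (Real.log K - Real.log S) := by
    rw [mul_mul_mul_comm, ← Real.exp_add]; ring_nf
  rw [this, Real.exp_sub, Real.exp_log hS, Real.exp_log hK]
  field_simp

/-- Completing the square shows that `S n(d₁)` and `K n(d₂)` both equal `√(K S) n(x / v) exp (-v² /
8)`. The `x / v²` contributions therefore cancel and the two halves add up. This symmetric form is
the one compared with the Bachelier vega. -/
theorem hasDerivAt_blackScholesCall {S K : ℝ} (hS : 0 < S) (hK : 0 < K) {v : ℝ} (hv : 0 < v) :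
    HasDerivAt (blackScholesCall S K 1)
      (Real.sqrt (K * S) * (normalDensity ((Real.log S - Real.log K) / v)
        * Real.exp (-(v ^ 2 / 8)))) v := by
  set x := Real.log S - Real.log K with hx
  have hd : HasDerivAt (fun u : ℝ => x / u) (-x / v ^ 2) v := by
    simpa [div_eq_mul_inv] using (hasDerivAt_inv hv.ne').const_mul x
  have hh : HasDerivAt (fun u : ℝ => u / 2) (1 / 2) v := (hasDerivAt_id v).div_const 2
  have h := (((hasDerivAt_normalCDF (x / v + v / 2)).comp v (hd.add hh)).const_mul S).sub
    (((hasDerivAt_normalCDF (x / v - v / 2)).comp v (hd.sub hh)).const_mul K)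
  have hSx : S * Real.exp (-(x / 2)) = Real.sqrt (K * S) := mul_exp_half_log hS hK
  have hKx : K * Real.exp (x / 2) = Real.sqrt (K * S) := by
    have := mul_exp_half_log hK hS
    rw [mul_comm K S, ← this, hx]; ring_nf
  have h' : HasDerivAt (fun u => S * normalCDF (x / u + u / 2) - K * normalCDF (x / u - u / 2))
      (Real.sqrt (K * S) * (normalDensity (x / v) * Real.exp (-(v ^ 2 / 8)))) v := by
    refine h.congr_deriv ?_
    rw [normalDensity_add_half hv.ne', normalDensity_sub_half hv.ne']
    linear_combination (normalDensity (x / v) * Real.exp (-(v ^ 2 / 8))) * (-x / v ^ 2 + 1 / 2) * hSx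
      - (normalDensity (x / v) * Real.exp (-(v ^ 2 / 8))) * (-x / v ^ 2 - 1 / 2) * hKx
  refine h'.congr_of_eventuallyEq ?_
  filter_upwards [lt_mem_nhds hv] with u hu using blackScholesCall_one_of_pos S K hu

theorem tendsto_bachelierCall_zero (S K : ℝ) :
    Tendsto (bachelierCall S K 1) (𝓝[>] 0) (𝓝 (max (S - K) 0)) := by
  have h1 : Tendsto (fun w : ℝ => w * normalDensity ((S - K) / w)) (𝓝[>] 0) (𝓝 0) := by
    refine squeeze_zero' (g := fun w => w) ?_ ?_ (tendsto_id.mono_left nhdsWithin_le_nhds)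
    · filter_upwards [self_mem_nhdsWithin] with w hw
      exact mul_nonneg (le_of_lt hw) (normalDensity_pos _).le
    · filter_upwards [self_mem_nhdsWithin] with w hw
      exact mul_le_of_le_one_right (le_of_lt hw) (normalDensity_le_one _)
  have h2 : Tendsto (fun w : ℝ => (S - K) * normalCDF ((S - K) / w)) (𝓝[>] 0)
      (𝓝 (max (S - K) 0)) := by
    rcases lt_trichotomy (S - K) 0 with hD | hD | hD
    · have : Tendsto (fun w : ℝ => (S - K) / w) (𝓝[>] 0) atBot := by
        simpa [div_eq_mul_inv] using tendsto_inv_nhdsGT_zero.const_mul_atTop_of_neg hD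
      rw [max_eq_right hD.le]
      simpa using (tendsto_normalCDF_atBot.comp this).const_mul (S - K)
    · simp [hD]
    · have : Tendsto (fun w : ℝ => (S - K) / w) (𝓝[>] 0) atTop := by
        simpa [div_eq_mul_inv] using tendsto_inv_nhdsGT_zero.const_mul_atTop hD
      rw [max_eq_left hD.le]
      simpa using (tendsto_normalCDF_atTop.comp this).const_mul (S - K)
  have h := h2.add h1
  rw [add_zero] at h
  refine h.congr' ?_
  filter_upwards [self_mem_nhdsWithin] with w hw using (bachelierCall_one_of_pos S K hw).symm

theorem tendsto_blackScholesCall_zero {S K : ℝ} (hS : 0 < S) (hK : 0 < K) :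
    Tendsto (blackScholesCall S K 1) (𝓝[>] 0) (𝓝 (max (S - K) 0)) := by
  set x := Real.log S - Real.log K with hx
  have hv : Tendsto (fun v : ℝ => v / 2) (𝓝[>] 0) (𝓝 0) := by
    have : Tendsto (fun v : ℝ => v / 2) (𝓝 0) (𝓝 (0 / 2)) := tendsto_id.div_const 2
    simpa using this.mono_left nhdsWithin_le_nhds
  have hv' : Tendsto (fun v : ℝ => -(v / 2)) (𝓝[>] 0) (𝓝 0) := by simpa using hv.neg
  have h : Tendsto (fun v => S * normalCDF (x / v + v / 2) - K * normalCDF (x / v - v / 2))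
      (𝓝[>] 0) (𝓝 (max (S - K) 0)) := by
    rcases lt_trichotomy S K with hD | hD | hD
    · have hx0 : x < 0 := sub_neg.2 (Real.log_lt_log hS hD)
      have : Tendsto (fun v : ℝ => x / v) (𝓝[>] 0) atBot := by
        simpa [div_eq_mul_inv] using tendsto_inv_nhdsGT_zero.const_mul_atTop_of_neg hx0
      rw [max_eq_right (by linarith)]
      simpa [sub_eq_add_neg] using
        ((tendsto_normalCDF_atBot.comp (this.atBot_add hv)).const_mul S).sub
        ((tendsto_normalCDF_atBot.comp (this.atBot_add hv')).const_mul K)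
    · have hx0 : x = 0 := by simp [hx, hD]
      have hc := (continuous_normalCDF.tendsto 0)
      simpa [hx0, hD] using ((hc.comp hv).const_mul S).sub ((hc.comp hv').const_mul K)
    · have hx0 : 0 < x := sub_pos.2 (Real.log_lt_log hK hD)
      have : Tendsto (fun v : ℝ => x / v) (𝓝[>] 0) atTop := by
        simpa [div_eq_mul_inv] using tendsto_inv_nhdsGT_zero.const_mul_atTop hx0
      rw [max_eq_left (by linarith)]
      simpa [sub_eq_add_neg] using
        ((tendsto_normalCDF_atTop.comp (this.atTop_add hv)).const_mul S).sub
        ((tendsto_normalCDF_atTop.comp (this.atTop_add hv')).const_mul K)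
  refine h.congr' ?_
  filter_upwards [self_mem_nhdsWithin] with v hv using (blackScholesCall_one_of_pos S K hv).symm

/-! ### Continuity, strict monotonicity and range of the prices in the total volatility -/

theorem continuousOn_Ici_of_hasDerivAt {f f' : ℝ → ℝ} (hf : ∀ x, 0 < x → HasDerivAt f (f' x) x)
    (h0 : Tendsto f (𝓝[>] 0) (𝓝 (f 0))) : ContinuousOn f (Ici 0) := by
  intro x hx
  rcases eq_or_lt_of_le (show (0 : ℝ) ≤ x from hx) with rfl | hx
  · exact continuousWithinAt_Ioi_iff_Ici.1 h0
  · exact (hf x hx).continuousAt.continuousWithinAt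

theorem strictMonoOn_Ici_of_hasDerivAt {f f' : ℝ → ℝ}
    (hf : ∀ x, 0 < x → HasDerivAt f (f' x) x) (hpos : ∀ x, 0 < x → 0 < f' x)
    (hc : ContinuousOn f (Ici 0)) : StrictMonoOn f (Ici 0) := by
  refine strictMonoOn_of_deriv_pos (convex_Ici 0) hc fun x hx => ?_
  rw [interior_Ici] at hx
  rw [(hf x hx).deriv]
  exact hpos x hx

theorem continuousOn_bachelierCall (S K : ℝ) : ContinuousOn (bachelierCall S K 1) (Ici 0) :=
  continuousOn_Ici_of_hasDerivAt (fun _ hw => hasDerivAt_bachelierCall S K hw)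
    (by rw [bachelierCall_zero]; exact tendsto_bachelierCall_zero S K)

theorem strictMonoOn_bachelierCall (S K : ℝ) : StrictMonoOn (bachelierCall S K 1) (Ici 0) :=
  strictMonoOn_Ici_of_hasDerivAt (fun _ hw => hasDerivAt_bachelierCall S K hw)
    (fun _ _ => normalDensity_pos _) (continuousOn_bachelierCall S K)

theorem continuousOn_blackScholesCall {S K : ℝ} (hS : 0 < S) (hK : 0 < K) :
    ContinuousOn (blackScholesCall S K 1) (Ici 0) :=
  continuousOn_Ici_of_hasDerivAt (fun _ hw => hasDerivAt_blackScholesCall hS hK hw)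
    (by rw [blackScholesCall_zero]; exact tendsto_blackScholesCall_zero hS hK)

theorem strictMonoOn_blackScholesCall {S K : ℝ} (hS : 0 < S) (hK : 0 < K) :
    StrictMonoOn (blackScholesCall S K 1) (Ici 0) :=
  strictMonoOn_Ici_of_hasDerivAt (fun _ hw => hasDerivAt_blackScholesCall hS hK hw)
    (fun _ _ => mul_pos (Real.sqrt_pos.2 (mul_pos hK hS))
      (mul_pos (normalDensity_pos _) (Real.exp_pos _)))
    (continuousOn_blackScholesCall hS hK)

theorem tendsto_bachelierCall_atTop (S K : ℝ) : Tendsto (bachelierCall S K 1) atTop atTop := by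
  have h0 : Tendsto (fun w : ℝ => (S - K) / w) atTop (𝓝 0) := tendsto_const_nhds.div_atTop tendsto_id
  have h1 := ((continuous_normalCDF.tendsto 0).comp h0).const_mul (S - K)
  have h2 := tendsto_id.atTop_mul_pos (normalDensity_pos 0)
    ((continuous_normalDensity.tendsto 0).comp h0)
  refine (h1.add_atTop h2).congr' ?_
  filter_upwards [eventually_gt_atTop 0] with w hw using (bachelierCall_one_of_pos S K hw).symm

theorem tendsto_blackScholesCall_atTop (S K : ℝ) :
    Tendsto (blackScholesCall S K 1) atTop (𝓝 S) := by
  set x := Real.log S - Real.log K with hx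
  have h0 : Tendsto (fun v : ℝ => x / v) atTop (𝓝 0) := tendsto_const_nhds.div_atTop tendsto_id
  have h1 : Tendsto (fun v : ℝ => v / 2) atTop atTop := tendsto_id.atTop_div_const two_pos
  have h2 : Tendsto (fun v : ℝ => -(v / 2)) atTop atBot := tendsto_neg_atTop_atBot.comp h1
  have h := ((tendsto_normalCDF_atTop.comp (h0.add_atTop h1)).const_mul S).sub
    ((tendsto_normalCDF_atBot.comp (h0.add_atBot h2)).const_mul K)
  rw [mul_one, mul_zero, sub_zero] at h
  refine h.congr' ?_
  filter_upwards [eventually_gt_atTop 0] with v hv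
  rw [blackScholesCall_one_of_pos S K hv]
  simp [hx, sub_eq_add_neg]

/-! ### Implied volatilities -/

theorem exists_eq_of_continuousOn_Ici {f : ℝ → ℝ} (hc : ContinuousOn f (Ici 0)) {c : ℝ}
    (h0 : f 0 ≤ c) (h1 : ∃ᶠ x in atTop, c ≤ f x) : ∃ x, 0 ≤ x ∧ f x = c := by
  obtain ⟨y, hy, hy0⟩ := (h1.and_eventually (eventually_ge_atTop 0)).exists
  obtain ⟨x, hx, hxc⟩ := intermediate_value_Icc hy0 (hc.mono Icc_subset_Ici_self) ⟨h0, hy⟩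
  exact ⟨x, hx.1, hxc⟩

/-- Injectivity makes the set a singleton, so the infimum is a genuine solution and not the default
value of `sInf` on the empty set. -/
theorem sInf_setOf_mul_sqrt_eq {f : ℝ → ℝ} (hf : InjOn f (Ici 0)) {w c T : ℝ} (hw : 0 ≤ w)
    (hfw : f w = c) (hT : 0 < T) :
    sInf {σ : ℝ | 0 ≤ σ ∧ f (σ * Real.sqrt T) = c} = w / Real.sqrt T := by
  have hT' : 0 < Real.sqrt T := Real.sqrt_pos.2 hT
  have : {σ : ℝ | 0 ≤ σ ∧ f (σ * Real.sqrt T) = c} = {w / Real.sqrt T} := by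
    ext σ
    simp only [mem_ofPred_eq, mem_singleton_iff]
    constructor
    · rintro ⟨h, h'⟩
      rw [eq_div_iff hT'.ne']
      exact hf (mul_nonneg h hT'.le) hw (h'.trans hfw.symm)
    · rintro rfl
      exact ⟨by positivity, by rw [div_mul_cancel₀ _ hT'.ne', hfw]⟩
  rw [this, csInf_singleton]

theorem normalImpliedVol_spec {S K T c : ℝ} (hT : 0 < T) (hc : max (S - K) 0 ≤ c) :
    0 ≤ normalImpliedVol S K T c ∧
      bachelierCall S K 1 (normalImpliedVol S K T c * Real.sqrt T) = c := by
  obtain ⟨w, hw, hwc⟩ := exists_eq_of_continuousOn_Ici (continuousOn_bachelierCall S K)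
    (by rwa [bachelierCall_zero])
    ((tendsto_bachelierCall_atTop S K).eventually_ge_atTop c).frequently
  have h : normalImpliedVol S K T c = w / Real.sqrt T := by
    simp only [normalImpliedVol, bachelierCall_eq_one S K T]
    exact sInf_setOf_mul_sqrt_eq (strictMonoOn_bachelierCall S K).injOn hw hwc hT
  rw [h, div_mul_cancel₀ _ (Real.sqrt_pos.2 hT).ne']
  exact ⟨by positivity, hwc⟩

theorem lognormalImpliedVol_spec {S K T c : ℝ} (hS : 0 < S) (hK : 0 < K) (hT : 0 < T)
    (hc : max (S - K) 0 ≤ c) (hcS : c < S) :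
    0 ≤ lognormalImpliedVol S K T c ∧
      blackScholesCall S K 1 (lognormalImpliedVol S K T c * Real.sqrt T) = c := by
  obtain ⟨w, hw, hwc⟩ := exists_eq_of_continuousOn_Ici (continuousOn_blackScholesCall hS hK)
    (by rwa [blackScholesCall_zero])
    ((tendsto_blackScholesCall_atTop S K).eventually (le_mem_nhds hcS)).frequently
  have h : lognormalImpliedVol S K T c = w / Real.sqrt T := by
    simp only [lognormalImpliedVol, blackScholesCall_eq_one S K T]
    exact sInf_setOf_mul_sqrt_eq (strictMonoOn_blackScholesCall hS hK).injOn hw hwc hT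
  rw [h, div_mul_cancel₀ _ (Real.sqrt_pos.2 hT).ne']
  exact ⟨by positivity, hwc⟩

/-! ### Expansion away from the money -/

/-- The logarithm of the ratio between the derivative of
`v ↦ bachelierCall S K 1 (A v (1 - B v² + M v⁴))` and the Black-Scholes vega, as a function of
`s = v²`, where `x` is the log-moneyness. -/
noncomputable def logVegaRatio (x B M s : ℝ) : ℝ :=
  x ^ 2 / 2 * ((2 * (-B + M * s) + s * (-B + M * s) ^ 2) / (1 + s * (-B + M * s)) ^ 2)
    + x ^ 2 * B + Real.log (1 - 3 * B * s + 5 * M * s ^ 2) + s / 8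

theorem logVegaRatio_zero (x B M : ℝ) : logVegaRatio x B M 0 = 0 := by
  simp [logVegaRatio]; ring

/-- `M` enters the slope linearly with coefficient `x ^ 2`, so for `x ≠ 0` the slope can be given
any prescribed value. -/
theorem hasDerivAt_logVegaRatio (x B M : ℝ) :
    HasDerivAt (logVegaRatio x B M)
      (x ^ 2 * M - 3 / 2 * x ^ 2 * B ^ 2 - 3 * B + 1 / 8) 0 := by
  have hid := hasDerivAt_id (0 : ℝ)
  have hη : HasDerivAt (fun s : ℝ => -B + M * s) (M * 1) 0 := (hid.const_mul M).const_add (-B)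
  have hden : HasDerivAt (fun s : ℝ => 1 + s * (-B + M * s)) _ 0 := (hid.mul hη).const_add 1
  have hnum : HasDerivAt (fun s : ℝ => 2 * (-B + M * s) + s * (-B + M * s) ^ 2) _ 0 :=
    (hη.const_mul 2).add (hid.mul (hη.pow 2))
  have hq : HasDerivAt (fun s : ℝ => 1 - 3 * B * s + 5 * M * s ^ 2) _ 0 :=
    ((hid.const_mul (3 * B)).const_sub 1).add ((hid.pow 2).const_mul (5 * M))
  have h := ((((hnum.div (hden.pow 2) (by simp)).const_mul (x ^ 2 / 2)).add_const (x ^ 2 * B)).add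
    (hq.log (by simp))).add (hid.div_const 8)
  refine h.congr_deriv ?_
  simp
  ring

/-- With `s = v²` and `η = -B + M s`, the Bachelier exponent is `-x² / (2 s (1 + s η)²)`. The
identity `1 - 1 / (1 + s η)² = s (2 η + s η²) / (1 + s η)²` splits off the Black-Scholes exponent
`-x² / (2 s)` and leaves a remainder regular at `s = 0`. -/
theorem bachelier_vega_comp_eq {x A B M r v : ℝ} (hr : 0 < r) (hA : A = r * Real.exp (x ^ 2 * B))
    (hv : 0 < v) (hp : 0 < 1 + v ^ 2 * (-B + M * v ^ 2))
    (hq : 0 < 1 - 3 * B * v ^ 2 + 5 * M * (v ^ 2) ^ 2) :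
    normalDensity (A * x / (A * v * (1 - B * v ^ 2 + M * v ^ 4)))
        * (A * (1 - 3 * B * v ^ 2 + 5 * M * (v ^ 2) ^ 2))
      = r * (normalDensity (x / v) * Real.exp (-(v ^ 2 / 8)))
        * Real.exp (logVegaRatio x B M (v ^ 2)) := by
  have hA0 : A ≠ 0 := by rw [hA]; positivity
  have e1 : A * x / (A * v * (1 - B * v ^ 2 + M * v ^ 4))
      = x / (v * (1 + v ^ 2 * (-B + M * v ^ 2))) := by
    rw [mul_assoc, mul_div_mul_left _ _ hA0]; ring_nf
  have e2 : -((x / (v * (1 + v ^ 2 * (-B + M * v ^ 2)))) ^ 2 / 2)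
      = -((x / v) ^ 2 / 2) + x ^ 2 / 2 * ((2 * (-B + M * v ^ 2) + v ^ 2 * (-B + M * v ^ 2) ^ 2)
        / (1 + v ^ 2 * (-B + M * v ^ 2)) ^ 2) := by
    have := hp.ne'
    generalize -B + M * v ^ 2 = η at *
    field_simp
    ring
  have e3 : Real.exp (-(v ^ 2 / 8)) * Real.exp (v ^ 2 / 8) = 1 := by
    rw [← Real.exp_add]; simp
  rw [e1]
  simp only [normalDensity, logVegaRatio]
  rw [e2, Real.exp_add, Real.exp_add, Real.exp_add, Real.exp_add, Real.exp_log hq, hA]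
  linear_combination (-(1 / Real.sqrt (2 * Real.pi) * Real.exp (-((x / v) ^ 2 / 2)) *
    Real.exp (x ^ 2 / 2 * ((2 * (-B + M * v ^ 2) + v ^ 2 * (-B + M * v ^ 2) ^ 2)
        / (1 + v ^ 2 * (-B + M * v ^ 2)) ^ 2)) * r * Real.exp (x ^ 2 * B) *
        (1 - 3 * B * v ^ 2 + 5 * M * (v ^ 2) ^ 2))) * e3

theorem exists_forall_Ioo_of_eventually {p : ℝ → Prop} (h : ∀ᶠ v in 𝓝[>] (0 : ℝ), p v) :
    ∃ δ, 0 < δ ∧ ∀ v ∈ Ioo 0 δ, p v := by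
  obtain ⟨δ, hδ, h⟩ := mem_nhdsGT_iff_exists_Ioo_subset.1 h
  exact ⟨δ, hδ, h⟩

/-- Only continuity is asked at `0`, where the price formulas are singular and hold as limits. -/
theorem le_of_hasDerivAt_le_Ioo {f g f' g' : ℝ → ℝ} {δ : ℝ} (hf : ContinuousOn f (Ico 0 δ))
    (hg : ContinuousOn g (Ico 0 δ)) (hf' : ∀ v ∈ Ioo 0 δ, HasDerivAt f (f' v) v)
    (hg' : ∀ v ∈ Ioo 0 δ, HasDerivAt g (g' v) v) (h0 : f 0 = g 0)
    (hle : ∀ v ∈ Ioo 0 δ, f' v ≤ g' v) : ∀ v ∈ Ico 0 δ, f v ≤ g v := by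
  intro v hv
  have hmono : MonotoneOn (g - f) (Ico 0 δ) := by
    refine monotoneOn_of_deriv_nonneg (convex_Ico 0 δ) (hg.sub hf) ?_ ?_ <;>
      rw [interior_Ico] <;> intro u hu
    · exact ((hg' u hu).sub (hf' u hu)).differentiableAt.differentiableWithinAt
    · rw [((hg' u hu).sub (hf' u hu)).deriv]
      exact sub_nonneg.2 (hle u hu)
  have := hmono ⟨le_rfl, hv.1.trans_lt hv.2⟩ hv hv.1
  simp only [Pi.sub_apply, h0, sub_self] at this
  linarith

theorem hasDerivAt_quintic (A B M v : ℝ) :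
    HasDerivAt (fun v : ℝ => A * v * (1 - B * v ^ 2 + M * v ^ 4))
      (A * (1 - 3 * B * v ^ 2 + 5 * M * (v ^ 2) ^ 2)) v := by
  have hid := hasDerivAt_id v
  have h := (hid.const_mul A).mul
    (((((hid.pow 2).const_mul B).const_sub 1)).add ((hid.pow 4).const_mul M))
  refine h.congr_deriv ?_
  simp
  ring

/-- The Bachelier price along a quintic total volatility: its derivative is the Black-Scholes vega
times `exp (logVegaRatio x B M (v ^ 2))`. -/
theorem exists_bachelierCall_quintic {S K A B M : ℝ} (hS : 0 < S) (hK : 0 < K)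
    (hA : A = Real.sqrt (K * S) * Real.exp ((Real.log S - Real.log K) ^ 2 * B))
    (hD : S - K = A * (Real.log S - Real.log K)) :
    ∃ δ, 0 < δ ∧ (∀ v ∈ Ico 0 δ, 0 ≤ A * v * (1 - B * v ^ 2 + M * v ^ 4)) ∧
      ContinuousOn (fun v => bachelierCall S K 1 (A * v * (1 - B * v ^ 2 + M * v ^ 4)))
        (Ico 0 δ) ∧
      ∀ v ∈ Ioo 0 δ, HasDerivAt
        (fun v => bachelierCall S K 1 (A * v * (1 - B * v ^ 2 + M * v ^ 4)))
        (Real.sqrt (K * S) * (normalDensity ((Real.log S - Real.log K) / v)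
          * Real.exp (-(v ^ 2 / 8)))
          * Real.exp (logVegaRatio (Real.log S - Real.log K) B M (v ^ 2))) v := by
  set x := Real.log S - Real.log K with hx
  have hr : 0 < Real.sqrt (K * S) := Real.sqrt_pos.2 (mul_pos hK hS)
  have hA0 : 0 < A := by rw [hA]; positivity
  have hp : ∀ᶠ v in 𝓝[>] (0 : ℝ), 0 < 1 + v ^ 2 * (-B + M * v ^ 2) := by
    have : Continuous fun v : ℝ => 1 + v ^ 2 * (-B + M * v ^ 2) := by fun_prop
    exact ((this.tendsto 0).eventually (lt_mem_nhds (by simp))).filter_mono nhdsWithin_le_nhds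
  have hq : ∀ᶠ v in 𝓝[>] (0 : ℝ), 0 < 1 - 3 * B * v ^ 2 + 5 * M * (v ^ 2) ^ 2 := by
    have : Continuous fun v : ℝ => 1 - 3 * B * v ^ 2 + 5 * M * (v ^ 2) ^ 2 := by fun_prop
    exact ((this.tendsto 0).eventually (lt_mem_nhds (by simp))).filter_mono nhdsWithin_le_nhds
  obtain ⟨δ, hδ, h⟩ := exists_forall_Ioo_of_eventually (hp.and hq)
  have hpos : ∀ v ∈ Ioo 0 δ, 0 < A * v * (1 - B * v ^ 2 + M * v ^ 4) := by
    intro v hv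
    have h1 : 1 - B * v ^ 2 + M * v ^ 4 = 1 + v ^ 2 * (-B + M * v ^ 2) := by ring
    rw [h1]
    exact mul_pos (mul_pos hA0 hv.1) (h v hv).1
  have hnn : ∀ v ∈ Ico 0 δ, 0 ≤ A * v * (1 - B * v ^ 2 + M * v ^ 4) := by
    intro v hv
    rcases eq_or_lt_of_le hv.1 with rfl | hv0
    · simp
    · exact (hpos v ⟨hv0, hv.2⟩).le
  refine ⟨δ, hδ, hnn, ?_, fun v hv => ?_⟩
  · exact (continuousOn_bachelierCall S K).comp
      (by fun_prop : Continuous fun v : ℝ => A * v * (1 - B * v ^ 2 + M * v ^ 4)).continuousOn hnn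
  · refine ((hasDerivAt_bachelierCall S K (hpos v hv)).comp v
      (hasDerivAt_quintic A B M v)).congr_deriv ?_
    rw [hD]
    exact bachelier_vega_comp_eq hr hA hv.1 (h v hv).1 (h v hv).2

theorem eventually_nhdsGT_of_hasDerivAt {L : ℝ → ℝ} {l : ℝ} (hL : HasDerivAt L l 0) (h0 : L 0 = 0)
    (hl : 0 < l) : ∀ᶠ v in 𝓝[>] (0 : ℝ), 0 ≤ L (v ^ 2) := by
  have h1 : ∀ᶠ s in 𝓝[>] (0 : ℝ), 0 < L s := by
    have := (hasDerivAt_iff_tendsto_slope.1 hL).eventually (lt_mem_nhds hl)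
    have := this.filter_mono (nhdsWithin_mono 0 (fun s (hs : 0 < s) => hs.ne'))
    filter_upwards [this, self_mem_nhdsWithin] with s hs hs0
    rw [slope_def_field, h0, sub_zero, sub_zero] at hs
    exact (div_pos_iff_of_pos_right hs0).1 hs
  have h2 : Tendsto (fun v : ℝ => v ^ 2) (𝓝[>] 0) (𝓝[>] 0) := by
    refine tendsto_nhdsWithin_iff.2 ⟨?_, ?_⟩
    · have : Continuous fun v : ℝ => v ^ 2 := by fun_prop
      simpa using (this.tendsto 0).mono_left nhdsWithin_le_nhds
    · filter_upwards [self_mem_nhdsWithin] with v hv using pow_pos (show (0 : ℝ) < v from hv) 2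
  exact (h2.eventually h1).mono fun _ h => h.le

/-- The quintics with slopes `1` and `-1` of `logVegaRatio` at `0` bound `w` from above and below;
they differ from the cubic only by `A M₁ v⁵` and `A M₂ v⁵`. -/
theorem exists_abs_bachelier_totalVol_sub_le {S K A B : ℝ} (hS : 0 < S) (hK : 0 < K)
    (hKS : K ≠ S) (hA : A = (S - K) / (Real.log S - Real.log K))
    (hB : B = Real.log (1 / Real.sqrt (K * S) * A) / (Real.log S - Real.log K) ^ 2) :
    ∃ δ, 0 < δ ∧ ∃ M, ∀ v ∈ Ico 0 δ, ∀ w, 0 ≤ w →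
      bachelierCall S K 1 w = blackScholesCall S K 1 v →
      |w - A * v * (1 - B * v ^ 2)| ≤ M * v ^ 5 := by
  set x := Real.log S - Real.log K with hx
  have hr : 0 < Real.sqrt (K * S) := Real.sqrt_pos.2 (mul_pos hK hS)
  have hA0 : 0 < A := by
    rw [hA]
    rcases lt_or_gt_of_ne hKS with h | h
    · exact div_pos (sub_pos.2 h) (sub_pos.2 (Real.log_lt_log hK h))
    · exact div_pos_of_neg_of_neg (sub_neg.2 h) (sub_neg.2 (Real.log_lt_log hS h))
  have hx0 : x ≠ 0 := sub_ne_zero.2 fun h => hKS (Real.log_injOn_pos hK hS h.symm)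
  have hD : S - K = A * x := by rw [hA]; field_simp
  have hA' : A = Real.sqrt (K * S) * Real.exp (x ^ 2 * B) := by
    rw [hB, mul_div_cancel₀ _ (by positivity), Real.exp_log (by positivity)]
    field_simp
  have hBS : ∀ δ, ContinuousOn (blackScholesCall S K 1) (Ico 0 δ) := fun δ =>
    (continuousOn_blackScholesCall hS hK).mono fun _ hv => hv.1
  -- The values `1` and `-1` are arbitrary; only the sign of the slope matters.
  obtain ⟨M₁, hM₁⟩ : ∃ M, x ^ 2 * M - 3 / 2 * x ^ 2 * B ^ 2 - 3 * B + 1 / 8 = 1 :=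
    ⟨(1 - 1 / 8 + 3 * B + 3 / 2 * x ^ 2 * B ^ 2) / x ^ 2, by field_simp; ring⟩
  obtain ⟨M₂, hM₂⟩ : ∃ M, x ^ 2 * M - 3 / 2 * x ^ 2 * B ^ 2 - 3 * B + 1 / 8 = -1 :=
    ⟨(-1 - 1 / 8 + 3 * B + 3 / 2 * x ^ 2 * B ^ 2) / x ^ 2, by field_simp; ring⟩
  have hL₁ := hasDerivAt_logVegaRatio x B M₁
  have hL₂ := (hasDerivAt_logVegaRatio x B M₂).neg
  rw [hM₁] at hL₁
  rw [hM₂, neg_neg] at hL₂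
  obtain ⟨δ₁, hδ₁, hn₁, hc₁, hd₁⟩ := exists_bachelierCall_quintic (M := M₁) hS hK hA' hD
  obtain ⟨δ₂, hδ₂, hn₂, hc₂, hd₂⟩ := exists_bachelierCall_quintic (M := M₂) hS hK hA' hD
  obtain ⟨δ₃, hδ₃, h₃⟩ := exists_forall_Ioo_of_eventually
    ((eventually_nhdsGT_of_hasDerivAt hL₁ (logVegaRatio_zero x B M₁) one_pos).and
      (eventually_nhdsGT_of_hasDerivAt hL₂ (by simp [logVegaRatio_zero]) one_pos))
  have hvega : ∀ v, 0 ≤ Real.sqrt (K * S) * (normalDensity (x / v) * Real.exp (-(v ^ 2 / 8))) :=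
    fun v => mul_nonneg hr.le (mul_nonneg (normalDensity_pos _).le (Real.exp_nonneg _))
  set δ := min δ₁ (min δ₂ δ₃)
  have hδ₁' : δ ≤ δ₁ := min_le_left _ _
  have hδ₂' : δ ≤ δ₂ := (min_le_right _ _).trans (min_le_left _ _)
  have hδ₃' : δ ≤ δ₃ := (min_le_right _ _).trans (min_le_right _ _)
  refine ⟨δ, by positivity, A * (|M₁| + |M₂|), fun v hv w hw hwv => ?_⟩
  have hup := le_of_hasDerivAt_le_Ioo (hBS δ) (hc₁.mono (Ico_subset_Ico_right hδ₁'))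
    (fun v hv => hasDerivAt_blackScholesCall hS hK hv.1)
    (fun v hv => hd₁ v (Ioo_subset_Ioo_right hδ₁' hv))
    (by simp [bachelierCall_zero, blackScholesCall_zero])
    (fun v hv => le_mul_of_one_le_right (hvega v)
      (Real.one_le_exp (h₃ v (Ioo_subset_Ioo_right hδ₃' hv)).1)) v hv
  have hlo := le_of_hasDerivAt_le_Ioo (hc₂.mono (Ico_subset_Ico_right hδ₂')) (hBS δ)
    (fun v hv => hd₂ v (Ioo_subset_Ioo_right hδ₂' hv))
    (fun v hv => hasDerivAt_blackScholesCall hS hK hv.1)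
    (by simp [bachelierCall_zero, blackScholesCall_zero])
    (fun v hv => mul_le_of_le_one_right (hvega v)
      (Real.exp_le_one_iff.2 (by simpa using (h₃ v (Ioo_subset_Ioo_right hδ₃' hv)).2))) v hv
  rw [← hwv] at hup hlo
  -- Strict monotonicity of the Bachelier price turns the order of prices into the order of total
  -- volatilities.
  have hup' := (strictMonoOn_bachelierCall S K).le_iff_le hw
    (hn₁ v (Ico_subset_Ico_right hδ₁' hv)) |>.1 hup
  have hlo' := (strictMonoOn_bachelierCall S K).le_iff_le
    (hn₂ v (Ico_subset_Ico_right hδ₂' hv)) hw |>.1 hlo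
  have hv5 : 0 ≤ A * v ^ 5 := by have := hv.1; positivity
  have b1 := mul_le_mul_of_nonneg_right (le_abs_self M₁) hv5
  have b2 := mul_le_mul_of_nonneg_right (neg_abs_le M₂) hv5
  have b3 := mul_nonneg (abs_nonneg M₁) hv5
  have b4 := mul_nonneg (abs_nonneg M₂) hv5
  rw [abs_le]
  constructor <;> linarith

/-! ### At the money -/

theorem bachelierCall_self (S : ℝ) {w : ℝ} (hw : 0 ≤ w) :
    bachelierCall S S 1 w = w / Real.sqrt (2 * Real.pi) := by
  rcases eq_or_lt_of_le hw with rfl | hw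
  · simp [bachelierCall_zero]
  · rw [bachelierCall_one_of_pos S S hw]
    simp [normalDensity, div_eq_mul_inv]

/-- At the money `d₁ = v / 2 = -d₂`, so the price is `S` times the Gaussian mass of a symmetric
interval. -/
theorem blackScholesCall_self (S : ℝ) {v : ℝ} (hv : 0 ≤ v) :
    blackScholesCall S S 1 v
      = S / Real.sqrt (2 * Real.pi) * ∫ u in (0 : ℝ)..v, Real.exp (-(u ^ 2 / 8)) := by
  rcases eq_or_lt_of_le hv with rfl | hv
  · simp [blackScholesCall_zero]
  · rw [blackScholesCall_one_of_pos S S hv, ← mul_sub, sub_self, zero_div, zero_add, zero_sub,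
      normalCDF_sub_normalCDF, div_mul_eq_mul_div, mul_div_assoc]
    congr 1
    have h1 : ∫ u in (-(v / 2))..(v / 2), normalDensity u
        = 1 / 2 * ∫ u in (-v)..v, normalDensity (u / 2) := by
      rw [intervalIntegral.integral_comp_div _ two_ne_zero, neg_div]
      simp
    have h2 : ∀ u : ℝ, normalDensity (u / 2)
        = 1 / Real.sqrt (2 * Real.pi) * Real.exp (-(u ^ 2 / 8)) := by
      intro u; unfold normalDensity; ring_nf
    have hi : ∀ a b : ℝ, IntervalIntegrable (fun u : ℝ => Real.exp (-(u ^ 2 / 8))) volume a b :=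
      fun a b => (by fun_prop : Continuous fun u : ℝ => Real.exp (-(u ^ 2 / 8))).intervalIntegrable a b
    have h3 : ∫ u in (-v)..0, Real.exp (-(u ^ 2 / 8)) = ∫ u in (0 : ℝ)..v, Real.exp (-(u ^ 2 / 8)) := by
      have := intervalIntegral.integral_comp_neg (fun u : ℝ => Real.exp (-(u ^ 2 / 8)))
        (a := 0) (b := v)
      simpa using this.symm
    rw [h1]
    simp only [h2, intervalIntegral.integral_const_mul]
    rw [← intervalIntegral.integral_add_adjacent_intervals (hi (-v) 0) (hi 0 v), h3]
    ring

theorem errorFunction_div (v : ℝ) :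
    Real.sqrt (2 * Real.pi) * errorFunction (v / (2 * Real.sqrt 2))
      = ∫ u in (0 : ℝ)..v, Real.exp (-(u ^ 2 / 8)) := by
  have h : ∀ u : ℝ, Real.exp (-(u ^ 2 / 8)) = Real.exp (-((u / (2 * Real.sqrt 2)) ^ 2)) := by
    intro u
    rw [div_pow, mul_pow, Real.sq_sqrt (by norm_num)]
    norm_num
  have hpi : Real.sqrt Real.pi ≠ 0 := (Real.sqrt_pos.2 Real.pi_pos).ne'
  simp only [h]
  rw [intervalIntegral.integral_comp_div (fun t => Real.exp (-(t ^ 2))) (by positivity),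
    zero_div, errorFunction, Real.sqrt_mul zero_le_two, smul_eq_mul]
  field_simp

theorem bachelier_totalVol_self {S v w : ℝ} (hv : 0 ≤ v) (hw : 0 ≤ w)
    (h : bachelierCall S S 1 w = blackScholesCall S S 1 v) :
    w = S * ∫ u in (0 : ℝ)..v, Real.exp (-(u ^ 2 / 8)) := by
  rw [bachelierCall_self S hw, blackScholesCall_self S hv] at h
  have : Real.sqrt (2 * Real.pi) ≠ 0 := by positivity
  field_simp at h
  exact h

/-- The integrand is compared with `1 - u² / 8`; from `|exp y - 1 - y| ≤ y²` for `|y| ≤ 1`, the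
pointwise error is at most `(u² / 8)² ≤ v⁴`. -/
theorem abs_integral_exp_sub_le {v : ℝ} (hv : 0 ≤ v) (hv1 : v ≤ 1) :
    |(∫ u in (0 : ℝ)..v, Real.exp (-(u ^ 2 / 8))) - v * (1 - v ^ 2 / 24)| ≤ v ^ 5 := by
  have h1 : ∫ u in (0 : ℝ)..v, (1 - u ^ 2 / 8) = v * (1 - v ^ 2 / 24) := by
    rw [intervalIntegral.integral_sub (by simp)
      ((by fun_prop : Continuous fun u : ℝ => u ^ 2 / 8).intervalIntegrable _ _)]
    simp [intervalIntegral.integral_div, integral_pow]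
    ring
  rw [← h1, ← intervalIntegral.integral_sub
    ((by fun_prop : Continuous fun u : ℝ => Real.exp (-(u ^ 2 / 8))).intervalIntegrable _ _)
    ((by fun_prop : Continuous fun u : ℝ => 1 - u ^ 2 / 8).intervalIntegrable _ _)]
  have h2 := intervalIntegral.norm_integral_le_of_norm_le_const (a := 0) (b := v) (C := v ^ 4)
    (f := fun u => Real.exp (-(u ^ 2 / 8)) - (1 - u ^ 2 / 8)) (fun u hu => ?_)
  · rw [sub_zero, abs_of_nonneg hv, Real.norm_eq_abs] at h2
    linarith [show v ^ 4 * v = v ^ 5 by ring]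
  · rw [uIoc_of_le hv] at hu
    have hu2 : u ^ 2 ≤ v ^ 2 := pow_le_pow_left₀ hu.1.le hu.2 2
    have hv2 : v ^ 2 ≤ 1 := pow_le_one₀ hv hv1
    have h3 := Real.abs_exp_sub_one_sub_id_le (x := -(u ^ 2 / 8))
      (by rw [abs_neg, abs_of_nonneg (by positivity)]; linarith)
    rw [Real.norm_eq_abs]
    have e : Real.exp (-(u ^ 2 / 8)) - (1 - u ^ 2 / 8)
        = Real.exp (-(u ^ 2 / 8)) - 1 - -(u ^ 2 / 8) := by ring
    rw [e]
    refine h3.trans ?_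
    nlinarith [sq_nonneg u]

theorem abs_bachelier_totalVol_self_sub_le {S v w : ℝ} (hS : 0 < S) (hv : v ∈ Ico 0 1)
    (hw : 0 ≤ w) (h : bachelierCall S S 1 w = blackScholesCall S S 1 v) :
    |w - S * v * (1 - 1 / 24 * v ^ 2)| ≤ S * v ^ 5 := by
  rw [bachelier_totalVol_self hv.1 hw h]
  have e : ∀ I : ℝ, S * I - S * v * (1 - 1 / 24 * v ^ 2) = S * (I - v * (1 - v ^ 2 / 24)) := by
    intro I; ring
  rw [e, abs_mul, abs_of_pos hS]
  exact mul_le_mul_of_nonneg_left (abs_integral_exp_sub_le hv.1 hv.2.le) hS.le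

/-! ### From total volatilities to implied volatilities -/

theorem tendsto_zero_of_tendsto_comp {f : ℝ → ℝ} (hf : StrictMonoOn f (Ici 0)) {v : ℝ → ℝ}
    {l : Filter ℝ} (hv : ∀ᶠ T in l, 0 ≤ v T) (h : Tendsto (fun T => f (v T)) l (𝓝 (f 0))) :
    Tendsto v l (𝓝 0) := by
  refine tendsto_order.2 ⟨fun a ha => hv.mono fun T hT => ha.trans_le hT, fun a ha => ?_⟩
  have h1 := h.eventually (gt_mem_nhds (hf self_mem_Ici ha.le ha))
  filter_upwards [h1, hv] with T hT hvT
  exact (hf.lt_iff_lt hvT ha.le).1 hT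

theorem tendsto_mul_sqrt_of_bounded {σ : ℝ → ℝ} (hσ : ∀ᶠ T in 𝓝[>] (0 : ℝ), 0 ≤ σ T)
    (hb : ∃ M : ℝ, ∀ᶠ T in 𝓝[>] (0 : ℝ), σ T ≤ M) :
    Tendsto (fun T => σ T * Real.sqrt T) (𝓝[>] 0) (𝓝 0) := by
  obtain ⟨M, hM⟩ := hb
  have hg : Tendsto (fun T => M * Real.sqrt T) (𝓝[>] 0) (𝓝 0) := by
    have : Continuous fun T => M * Real.sqrt T := by fun_prop
    simpa using (this.tendsto 0).mono_left nhdsWithin_le_nhds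
  refine squeeze_zero' ?_ ?_ hg
  · exact hσ.mono fun T h => mul_nonneg h (Real.sqrt_nonneg _)
  · exact hM.mono fun T h => mul_le_mul_of_nonneg_right h (Real.sqrt_nonneg _)

section ImpliedVol

variable {σN σL : ℝ → ℝ} {A B M : ℝ}

/-- After division by `√T`, the error `M v⁵` becomes `M σL⁵ T²`, and `σL` is bounded. -/
theorem isBigO_sq_of_totalVol_bound
    (hσ : ∀ᶠ T in 𝓝[>] (0 : ℝ), 0 ≤ σL T) (hb : ∃ M : ℝ, ∀ᶠ T in 𝓝[>] (0 : ℝ), σL T ≤ M)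
    (h : ∀ᶠ T in 𝓝[>] (0 : ℝ), |σN T * Real.sqrt T - A * (σL T * Real.sqrt T)
      * (1 - B * (σL T * Real.sqrt T) ^ 2)| ≤ M * (σL T * Real.sqrt T) ^ 5) :
    (fun T => σN T - A * σL T * (1 - B * (σL T ^ 2 * T))) =O[𝓝[>] 0] fun T => T ^ 2 := by
  obtain ⟨M', hM'⟩ := hb
  -- The absolute value is needed because the sign of `M` is not known.
  refine IsBigO.of_bound (|M| * M' ^ 5) ?_
  filter_upwards [hσ, hM', h, self_mem_nhdsWithin] with T h0 h1 h2 hT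
  have hT : 0 < T := hT
  have hs : 0 < Real.sqrt T := Real.sqrt_pos.2 hT
  have hsq : Real.sqrt T ^ 2 = T := Real.sq_sqrt hT.le
  have e1 : σN T * Real.sqrt T - A * (σL T * Real.sqrt T) * (1 - B * (σL T * Real.sqrt T) ^ 2)
      = (σN T - A * σL T * (1 - B * (σL T ^ 2 * T))) * Real.sqrt T := by
    rw [mul_pow, hsq]; ring
  have e2 : M * (σL T * Real.sqrt T) ^ 5 = M * σL T ^ 5 * T ^ 2 * Real.sqrt T := by
    rw [← hsq]
    simp only [Real.sqrt_sq hs.le]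
    ring
  rw [e1, e2, abs_mul, abs_of_pos hs] at h2
  rw [Real.norm_eq_abs, Real.norm_eq_abs, abs_of_pos (by positivity : 0 < T ^ 2)]
  refine (le_of_mul_le_mul_right h2 hs).trans (mul_le_mul_of_nonneg_right ?_ (by positivity))
  calc M * σL T ^ 5 ≤ |M| * σL T ^ 5 := mul_le_mul_of_nonneg_right (le_abs_self M) (by positivity)
    _ ≤ |M| * M' ^ 5 := mul_le_mul_of_nonneg_left (pow_le_pow_left₀ h0 h1 5) (abs_nonneg M)

/-- The error relative to `σL` is at most `|A B| v² + |M| v⁴`, which vanishes as `v → 0` even if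
`σL` is unbounded. -/
theorem isEquivalent_of_totalVol_bound (hA : A ≠ 0)
    (hσ : ∀ᶠ T in 𝓝[>] (0 : ℝ), 0 ≤ σL T)
    (hv : Tendsto (fun T => σL T * Real.sqrt T) (𝓝[>] 0) (𝓝 0))
    (h : ∀ᶠ T in 𝓝[>] (0 : ℝ), |σN T * Real.sqrt T - A * (σL T * Real.sqrt T)
      * (1 - B * (σL T * Real.sqrt T) ^ 2)| ≤ M * (σL T * Real.sqrt T) ^ 5) :
    σN ~[𝓝[>] 0] fun T => A * σL T := by
  have hg : Tendsto (fun T => |A * B| * (σL T * Real.sqrt T) ^ 2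
      + |M| * (σL T * Real.sqrt T) ^ 4) (𝓝[>] 0) (𝓝 0) := by
    simpa using ((hv.pow 2).const_mul |A * B|).add ((hv.pow 4).const_mul |M|)
  have ho : (fun T => σN T - A * σL T) =o[𝓝[>] 0] σL := by
    refine IsLittleO.of_bound fun c hc => ?_
    filter_upwards [hσ, h, self_mem_nhdsWithin, hg.eventually (gt_mem_nhds hc)]
      with T h0 h1 hT h2
    have hs : 0 < Real.sqrt T := Real.sqrt_pos.2 hT
    rw [Real.norm_eq_abs, Real.norm_eq_abs, abs_of_nonneg h0]
    refine le_of_mul_le_mul_right ?_ hs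
    rw [← abs_of_pos hs, ← abs_mul, abs_of_pos hs, mul_assoc c]
    have hv0 : 0 ≤ σL T * Real.sqrt T := mul_nonneg h0 hs.le
    have e : (σN T - A * σL T) * Real.sqrt T
        = (σN T * Real.sqrt T - A * (σL T * Real.sqrt T) * (1 - B * (σL T * Real.sqrt T) ^ 2))
          - A * B * (σL T * Real.sqrt T) ^ 3 := by ring
    rw [e]
    generalize σL T * Real.sqrt T = v at *
    refine (abs_sub _ _).trans ?_
    rw [abs_mul, abs_of_nonneg (by positivity : 0 ≤ v ^ 3)]
    have h3 := mul_le_mul_of_nonneg_right h2.le hv0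
    have h4 := mul_le_mul_of_nonneg_right (le_abs_self M) (by positivity : 0 ≤ v ^ 5)
    linarith
  exact ho.trans_isBigO ((isBigO_refl σL _).const_mul_right hA)

end ImpliedVol

/-! ### The expansions and equivalences of the implied volatilities -/

theorem isBigO_sq_mul_log :
    (fun T : ℝ => T ^ 2) =O[𝓝[>] 0] fun T => T ^ 2 * Real.log T := by
  refine IsBigO.of_bound 1 ?_
  have h := Real.tendsto_log_nhdsGT_zero.eventually_le_atBot (-1)
  filter_upwards [h] with T hT
  rw [one_mul, norm_mul, Real.norm_eq_abs (Real.log T)]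
  refine le_mul_of_one_le_right (norm_nonneg _) ?_
  rw [abs_of_nonpos (by linarith)]
  linarith

theorem corollary2 (S K : ℝ) (hS : 0 < S) (hK : 0 < K) (T₀ : ℝ) (hT₀ : 0 < T₀)
    -- the market price of the call of strike `K`, as a function of its maturity
    (C : ℝ → ℝ)
    (hC : ∀ T ∈ Ioo 0 T₀, max (S - K) 0 ≤ C T ∧ C T < S)
    (σN σLN : ℝ → ℝ)
    (hσN : σN = fun T => normalImpliedVol S K T (C T))
    (hσLN : σLN = fun T => lognormalImpliedVol S K T (C T)) :
    (K ≠ S →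
      ((∃ M : ℝ, ∀ᶠ T in 𝓝[>] (0 : ℝ), σLN T ≤ M) →
        (fun T => σN T -
          (S - K) / (Real.log S - Real.log K) * σLN T *
            (1 - Real.log (1 / Real.sqrt (K * S) * ((S - K) / (Real.log S - Real.log K))) /
                (Real.log S - Real.log K) ^ 2 * (σLN T ^ 2 * T)))
          =O[𝓝[>] 0] fun T => T ^ 2 * Real.log T) ∧
      (Tendsto C (𝓝[>] 0) (𝓝 (max (S - K) 0)) →
        σN ~[𝓝[>] 0] fun T => (S - K) / (Real.log S - Real.log K) * σLN T)) ∧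
    (K = S →
      (∀ T ∈ Ioo 0 T₀,
        σN T = Real.sqrt (2 * Real.pi / T) * S *
          errorFunction (σLN T * Real.sqrt T / (2 * Real.sqrt 2))) ∧
      ((∃ M : ℝ, ∀ᶠ T in 𝓝[>] (0 : ℝ), σLN T ≤ M) →
        (fun T => σN T - S * σLN T * (1 - σLN T ^ 2 * T / 24)) =o[𝓝[>] 0] fun T => T) ∧
      (Tendsto C (𝓝[>] 0) (𝓝 (max (S - K) 0)) →
        σN ~[𝓝[>] 0] fun T => S * σLN T)) := by
  have hT : ∀ᶠ T in 𝓝[>] (0 : ℝ), T ∈ Ioo 0 T₀ := Ioo_mem_nhdsGT hT₀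
  have hN : ∀ T ∈ Ioo 0 T₀, 0 ≤ σN T ∧ bachelierCall S K 1 (σN T * Real.sqrt T) = C T := by
    intro T hT
    rw [hσN]
    exact normalImpliedVol_spec hT.1 (hC T hT).1
  have hL : ∀ T ∈ Ioo 0 T₀, 0 ≤ σLN T ∧ blackScholesCall S K 1 (σLN T * Real.sqrt T) = C T := by
    intro T hT
    rw [hσLN]
    exact lognormalImpliedVol_spec hS hK hT.1 (hC T hT).1 (hC T hT).2
  -- From here on, only nonnegativity and the two pricing equations are used.
  clear hσN hσLN
  have hσ : ∀ᶠ T in 𝓝[>] (0 : ℝ), 0 ≤ σLN T := hT.mono fun T hT => (hL T hT).1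
  have hv0 : ∀ᶠ T in 𝓝[>] (0 : ℝ), 0 ≤ σLN T * Real.sqrt T :=
    hσ.mono fun T h => mul_nonneg h (Real.sqrt_nonneg T)
  have hlim : Tendsto C (𝓝[>] 0) (𝓝 (max (S - K) 0)) →
      Tendsto (fun T => σLN T * Real.sqrt T) (𝓝[>] 0) (𝓝 0) := by
    intro h
    refine tendsto_zero_of_tendsto_comp (strictMonoOn_blackScholesCall hS hK) hv0 ?_
    rw [blackScholesCall_zero]
    exact h.congr' (hT.mono fun T hT => (hL T hT).2.symm)
  -- A bound valid for small `v` becomes one valid for small `T` once `v → 0`; both the case `K ≠ S`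
  -- and the case `K = S` use it.
  have hbound : ∀ {A B M δ : ℝ}, 0 < δ → (∀ v ∈ Ico 0 δ, ∀ w, 0 ≤ w →
      bachelierCall S K 1 w = blackScholesCall S K 1 v →
      |w - A * v * (1 - B * v ^ 2)| ≤ M * v ^ 5) →
      Tendsto (fun T => σLN T * Real.sqrt T) (𝓝[>] 0) (𝓝 0) →
      ∀ᶠ T in 𝓝[>] (0 : ℝ), |σN T * Real.sqrt T - A * (σLN T * Real.sqrt T)
        * (1 - B * (σLN T * Real.sqrt T) ^ 2)| ≤ M * (σLN T * Real.sqrt T) ^ 5 := by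
    intro A B M δ hδ h hv
    filter_upwards [hT, hv0, hv.eventually (gt_mem_nhds hδ)] with T hT h0 h1
    exact h _ ⟨h0, h1⟩ _ (mul_nonneg (hN T hT).1 (Real.sqrt_nonneg T))
      ((hN T hT).2.trans (hL T hT).2.symm)
  refine ⟨fun hKS => ?_, fun hKS => ?_⟩
  · obtain ⟨δ, hδ, M, h⟩ := exists_abs_bachelier_totalVol_sub_le hS hK hKS rfl rfl
    refine ⟨fun hb => ?_, fun hCl => ?_⟩
    · exact (isBigO_sq_of_totalVol_bound hσ hb
        (hbound hδ h (tendsto_mul_sqrt_of_bounded hσ hb))).trans isBigO_sq_mul_log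
    · refine isEquivalent_of_totalVol_bound (div_ne_zero (sub_ne_zero.2 hKS.symm) ?_) hσ (hlim hCl)
        (hbound hδ h (hlim hCl))
      exact sub_ne_zero.2 fun h => hKS (Real.log_injOn_pos hK hS h.symm)
  · subst hKS
    have h : ∀ v ∈ Ico (0 : ℝ) 1, ∀ w, 0 ≤ w →
        bachelierCall K K 1 w = blackScholesCall K K 1 v →
        |w - K * v * (1 - 1 / 24 * v ^ 2)| ≤ K * v ^ 5 :=
      fun v hv w hw => abs_bachelier_totalVol_self_sub_le hK hv hw
    refine ⟨fun T hT => ?_, fun hb => ?_, fun hCl => ?_⟩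
    · have hs : 0 < Real.sqrt T := Real.sqrt_pos.2 hT.1
      have e := bachelier_totalVol_self (mul_nonneg (hL T hT).1 hs.le)
        (mul_nonneg (hN T hT).1 hs.le) ((hN T hT).2.trans (hL T hT).2.symm)
      rw [← errorFunction_div] at e
      rw [Real.sqrt_div (by positivity), div_mul_eq_mul_div, div_mul_eq_mul_div, eq_div_iff hs.ne',
        e]
      ring
    · have h1 := isBigO_sq_of_totalVol_bound hσ hb
        (hbound one_pos h (tendsto_mul_sqrt_of_bounded hσ hb))
      have h2 : (fun T : ℝ => T ^ 2) =o[𝓝[>] 0] fun T => T := by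
        simpa using (isLittleO_pow_pow (𝕜 := ℝ) one_lt_two).mono nhdsWithin_le_nhds
      refine (h1.trans_isLittleO h2).congr_left fun T => ?_
      ring
    · exact isEquivalent_of_totalVol_bound hK.ne' hσ (hlim hCl) (hbound one_pos h (hlim hCl))
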